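/- A zonotope in $\mathbb{R}^n$ is a finite vector (Minkowski) sum of segments, and a zonoid in $\mathbb{R}^n$ is a compact set that is a limit of zonotopes in the Hausdorff metric. The polar of a set $Z \subset \mathbb{R}^n$ is $Z^\circ = \{y \in \mathbb{R}^n : \langle x, y\rangle \le 1 \text{ for all } x \in Z\}$. A proper face of a convex set $Z$ is a nonempty convex subset $F \subsetneq Z$ such that whenever $x, y \in Z$ and some point of the open segment $(x,y)$ lies in $F$, both $x$ and $y$ lie in $F$; the dimension of a set is the dimension of its affine hull. Let $n \ge 3$ and let $Z \subset \mathbb{R}^n$ be an $n$-dimensional zonoid with center of symmetry at the origin (so that $Z$ is the unit ball of a norm) whose polar $Z^\circ$ is also a zonoid. Then every proper face of $Z$ has dimension $0$ or $n-1$; that is, the boundary of $Z$ contains no proper faces other than vertices and facets. -/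

import Mathlib

open Filter Topology
open scoped Pointwise

/-- A zonotope: a (finite) vector sum of segments. -/
def IsZonotope {n : ℕ} (P : Set (EuclideanSpace ℝ (Fin n))) : Prop :=
  ∃ (m : ℕ) (a b : Fin m → EuclideanSpace ℝ (Fin n)), P = ∑ i, segment ℝ (a i) (b i)

/-- A zonoid: a compact set that is a limit of zonotopes in the Hausdorff metric. (The Hausdorff
extended distance from a nonempty set to the empty set is `⊤`, so a zonoid is nonempty.) -/
def IsZonoid {n : ℕ} (Z : Set (EuclideanSpace ℝ (Fin n))) : Prop :=
  IsCompact Z ∧ ∃ P : ℕ → Set (EuclideanSpace ℝ (Fin n)),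
    (∀ k, IsZonotope (P k)) ∧ Tendsto (fun k => Metric.hausdorffEDist (P k) Z) atTop (𝓝 0)

/-- The polar `K° = {y : ⟨x, y⟩ ≤ 1 for all x ∈ K}`. -/
def polarBody {n : ℕ} (K : Set (EuclideanSpace ℝ (Fin n))) : Set (EuclideanSpace ℝ (Fin n)) :=
  {y | ∀ x ∈ K, inner ℝ x y ≤ 1}

/-- The (affine) dimension of a nonempty subset of `ℝⁿ`: the dimension of its affine hull. -/
noncomputable def affineDim {n : ℕ} (K : Set (EuclideanSpace ℝ (Fin n))) : ℕ :=
  Module.finrank ℝ (vectorSpan ℝ K)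

/-- `F` is a proper face of the convex set `K`: a nonempty convex subset, different from `K`, that
contains both end points of every segment in `K` of which it contains a relatively interior
point. Every support set of `K` (intersection with a support hyperplane) that is different from
`K` is of this kind. -/
structure IsProperFace {n : ℕ} (K F : Set (EuclideanSpace ℝ (Fin n))) : Prop where
  nonempty : F.Nonempty
  convex : Convex ℝ F
  isExtreme : IsExtreme ℝ K F
  ne : F ≠ K

/-!
The proof plays two properties against each other, where `F` is a face of `Z` of dimension between
`1` and `n - 2`, `x ≠ y` are points of `F` and `w = (x - y) / 2`.

Since `Z` is a zonoid, its face `F` is a summand of `Z` up to translation, so for every direction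
`u ⟂ F` the support set of `Z` in direction `u` contains a translate `[v - w, v + w]` of `[y, x]`
(`IsZonoid.exists_translate_face`). This is proved by an explicit choice of coefficients in zonotopes
(`IsZonotope.exists_translate`) and passage to the limit, without representing measures. The
directions `u ⟂ F` form a sphere of dimension at least one, which is connected, and the midpoints
`v` over `u` and `-u` are opposite; hence the set of all midpoints `v` meets every hyperplane through
the origin (`exists_support_inner_eq_zero`).

On the other hand, the norm `N` with unit ball `Z` is the support function of the zonoid `Z°`, so it
is a limit of finite sums `∑ i, |⟪·, θ i⟫|`. The norm is constantly `1` on each `[v - w, v + w]`. For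
a single absolute value, `|⟪v + w, θ⟫| + |⟪v - w, θ⟫| = 2 |⟪v, θ⟫|` means `|⟪w, θ⟫| ≤ |⟪v, θ⟫|`.
Since every `θ` is orthogonal to some `v`, this forces `⟪w, θ⟫ = 0` throughout, thus `N w = 0`.
To survive the limit, this is made quantitative by summing second differences of `N` over a finite
`ε`-net of midpoints (`sum_secondDiff_ge`, `IsZonoid.inner_le_zero_of_secondDiff`). So `w = 0`, a
contradiction.
-/

/-! ### Zonotopes in coordinates -/

/-- A zonotope is the image of a cube under an affine map: a sum of segments with midpoints summing
to `c` and half-difference vectors `θ i` consists of the points `c + ∑ f i • θ i`, `|f i| ≤ 1`. -/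
theorem IsZonotope.exists_repr {n : ℕ} {P : Set (EuclideanSpace ℝ (Fin n))} (hP : IsZonotope P) :
    ∃ (m : ℕ) (c : EuclideanSpace ℝ (Fin n)) (θ : Fin m → EuclideanSpace ℝ (Fin n)),
      ∀ x, x ∈ P ↔ ∃ f : Fin m → ℝ, (∀ i, |f i| ≤ 1) ∧ x = c + ∑ i, f i • θ i := by
  obtain ⟨m, a, b, rfl⟩ := hP
  refine ⟨m, ∑ i, (1 / 2 : ℝ) • (a i + b i), fun i => (1 / 2 : ℝ) • (b i - a i), fun x => ?_⟩
  rw [Set.mem_fintype_sum]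
  constructor
  · rintro ⟨g, hg, rfl⟩
    have hg' : ∀ i, ∃ t : ℝ, t ∈ Set.Icc (0 : ℝ) 1 ∧ (1 - t) • a i + t • b i = g i := by
      intro i
      have h := hg i
      rw [segment_eq_image] at h
      exact h
    choose t ht hgt using hg'
    refine ⟨fun i => 2 * t i - 1, fun i => ?_, ?_⟩
    · rw [abs_le]
      constructor <;> linarith [(ht i).1, (ht i).2]
    · rw [← Finset.sum_add_distrib]
      refine Finset.sum_congr rfl fun i _ => ?_
      rw [← hgt i]
      module
  · rintro ⟨f, hf, rfl⟩
    refine ⟨fun i => (1 - (f i + 1) / 2) • a i + ((f i + 1) / 2) • b i, fun i => ?_, ?_⟩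
    · rw [segment_eq_image]
      have := abs_le.1 (hf i)
      exact ⟨(f i + 1) / 2, ⟨by linarith, by linarith⟩, rfl⟩
    · rw [← Finset.sum_add_distrib]
      refine Finset.sum_congr rfl fun i _ => ?_
      module

theorem IsZonotope.convex {n : ℕ} {P : Set (EuclideanSpace ℝ (Fin n))} (hP : IsZonotope P) :
    Convex ℝ P := by
  obtain ⟨m, c, θ, hm⟩ := hP.exists_repr
  intro x hx y hy a b ha hb hab
  obtain ⟨f, hf, rfl⟩ := (hm x).1 hx
  obtain ⟨g, hg, rfl⟩ := (hm y).1 hy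
  refine (hm _).2 ⟨fun i => a * f i + b * g i, fun i => ?_, ?_⟩
  · have h1 := abs_le.1 (hf i)
    have h2 := abs_le.1 (hg i)
    rw [abs_le]
    constructor <;> nlinarith
  · simp only [add_smul, mul_smul, Finset.sum_add_distrib, ← Finset.smul_sum, smul_add]
    linear_combination (norm := module) hab • c

/-- With `x = c + ∑ f i • θ i` and `y = c + ∑ g i • θ i`, put `d = (f - g) / 2`. In a zonotope the
midpoint of `x` and `y` can be moved by `± e`, `e = ∑ |d i| σ i • θ i`, where `σ i` is the sign
of `⟪u, θ i⟫`; and the point `p` whose coefficients are `σ i (1 - |d i|)` carries a translate of the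
segment from `x` to `y` on which `u` is within `2 ⟪u, e⟫` of its maximum. -/
theorem IsZonotope.exists_translate {n : ℕ} {P : Set (EuclideanSpace ℝ (Fin n))}
    (hP : IsZonotope P) {x y : EuclideanSpace ℝ (Fin n)} (hx : x ∈ P) (hy : y ∈ P)
    (u : EuclideanSpace ℝ (Fin n)) :
    ∃ e p : EuclideanSpace ℝ (Fin n),
      (1 / 2 : ℝ) • (x + y) + e ∈ P ∧ (1 / 2 : ℝ) • (x + y) - e ∈ P ∧
      p + (1 / 2 : ℝ) • (x - y) ∈ P ∧ p - (1 / 2 : ℝ) • (x - y) ∈ P ∧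
      ∀ q ∈ P, inner ℝ u q ≤ inner ℝ u (p + (1 / 2 : ℝ) • (x - y)) + 2 * inner ℝ u e := by
  obtain ⟨m, c, θ, hm⟩ := hP.exists_repr
  obtain ⟨f, hf, rfl⟩ := (hm x).1 hx
  obtain ⟨g, hg, rfl⟩ := (hm y).1 hy
  set s : Fin m → ℝ := fun i => (SignType.sign (inner ℝ u (θ i)) : ℝ) with hs
  have hs1 : ∀ i, |s i| ≤ 1 := by
    intro i
    simp only [hs]
    rcases SignType.trichotomy (SignType.sign (inner ℝ u (θ i))) with h | h | h <;> rw [h] <;> simp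
  have hsu : ∀ i, s i * inner ℝ u (θ i) = |inner ℝ u (θ i)| := fun i => sign_mul_self _
  set d : Fin m → ℝ := fun i => (f i - g i) / 2 with hd
  have hfg : ∀ i, |(f i + g i) / 2| + |d i| ≤ 1 := by
    intro i
    have h1 := abs_le.1 (hf i)
    have h2 := abs_le.1 (hg i)
    simp only [hd]
    rcases abs_cases ((f i + g i) / 2) with h | h <;>
      rcases abs_cases ((f i - g i) / 2) with h' | h' <;> linarith
  have hd1 : ∀ i, |d i| ≤ 1 := fun i => by linarith [hfg i, abs_nonneg ((f i + g i) / 2)]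
  have hmid : (1 / 2 : ℝ) • (c + ∑ i, f i • θ i + (c + ∑ i, g i • θ i))
      = c + ∑ i, ((f i + g i) / 2) • θ i := by
    have : ∑ i, ((f i + g i) / 2) • θ i = (1 / 2 : ℝ) • (∑ i, f i • θ i + ∑ i, g i • θ i) := by
      rw [← Finset.sum_add_distrib, Finset.smul_sum]
      refine Finset.sum_congr rfl fun i _ => ?_
      module
    rw [this]
    module
  have hdiff : (1 / 2 : ℝ) • (c + ∑ i, f i • θ i - (c + ∑ i, g i • θ i)) = ∑ i, d i • θ i := by
    rw [add_sub_add_left_eq_sub, ← Finset.sum_sub_distrib, Finset.smul_sum]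
    refine Finset.sum_congr rfl fun i _ => ?_
    simp only [hd]
    module
  rw [hmid, hdiff]
  have hds : ∀ i, |(|d i| * s i)| ≤ |d i| := by
    intro i
    rw [abs_mul, abs_abs]
    exact mul_le_of_le_one_right (abs_nonneg _) (hs1 i)
  have hsd : ∀ i, |s i * (1 - |d i|)| ≤ 1 - |d i| := by
    intro i
    have := hd1 i
    rw [abs_mul, abs_of_nonneg (by linarith : 0 ≤ 1 - |d i|)]
    exact mul_le_of_le_one_left (by linarith) (hs1 i)
  refine ⟨∑ i, (|d i| * s i) • θ i, c + ∑ i, (s i * (1 - |d i|)) • θ i, ?_, ?_, ?_, ?_, ?_⟩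
  · refine (hm _).2 ⟨fun i => (f i + g i) / 2 + |d i| * s i, fun i => ?_, ?_⟩
    · exact (abs_add_le _ _).trans ((add_le_add le_rfl (hds i)).trans (hfg i))
    · simp only [add_smul, Finset.sum_add_distrib, add_assoc]
  · refine (hm _).2 ⟨fun i => (f i + g i) / 2 - |d i| * s i, fun i => ?_, ?_⟩
    · exact (abs_sub _ _).trans ((add_le_add le_rfl (hds i)).trans (hfg i))
    · simp only [sub_smul, Finset.sum_sub_distrib, add_sub_assoc]
  · refine (hm _).2 ⟨fun i => s i * (1 - |d i|) + d i, fun i => ?_, ?_⟩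
    · exact (abs_add_le _ _).trans (by linarith [hsd i])
    · simp only [add_smul, Finset.sum_add_distrib, add_assoc]
  · refine (hm _).2 ⟨fun i => s i * (1 - |d i|) - d i, fun i => ?_, ?_⟩
    · exact (abs_sub _ _).trans (by linarith [hsd i])
    · simp only [sub_smul, Finset.sum_sub_distrib, add_sub_assoc]
  · intro q hq
    obtain ⟨h, hh, rfl⟩ := (hm q).1 hq
    simp only [inner_add_right, inner_sum, inner_smul_right]
    rw [add_assoc, add_assoc, Finset.mul_sum, ← Finset.sum_add_distrib, ← Finset.sum_add_distrib]
    refine add_le_add le_rfl (Finset.sum_le_sum fun i _ => ?_)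
    have e1 : s i * (1 - |d i|) * inner ℝ u (θ i) + (d i * inner ℝ u (θ i)
        + 2 * (|d i| * s i * inner ℝ u (θ i)))
        = (1 + |d i|) * |inner ℝ u (θ i)| + d i * inner ℝ u (θ i) := by
      rw [← hsu i]; ring
    rw [e1]
    have e2 : h i * inner ℝ u (θ i) ≤ |inner ℝ u (θ i)| := by
      refine (le_abs_self _).trans ?_
      rw [abs_mul]
      exact mul_le_of_le_one_left (abs_nonneg _) (hh i)
    have e3 := neg_abs_le (d i * inner ℝ u (θ i))
    rw [abs_mul] at e3
    linarith

/-! ### Zonoids as limits -/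

theorem IsZonoid.exists_approx {n : ℕ} {Z : Set (EuclideanSpace ℝ (Fin n))} (hZ : IsZonoid Z)
    {δ : ℝ} (hδ : 0 < δ) :
    ∃ P, IsZonotope P ∧ (∀ p ∈ P, ∃ z ∈ Z, dist p z < δ) ∧ ∀ z ∈ Z, ∃ p ∈ P, dist z p < δ := by
  obtain ⟨-, P, hP, hlim⟩ := hZ
  obtain ⟨k, hk⟩ := (hlim.eventually (gt_mem_nhds (ENNReal.ofReal_pos.2 hδ))).exists
  refine ⟨P k, hP k, fun p hp => ?_, fun z hz => ?_⟩
  · obtain ⟨z, hz, h⟩ := Metric.exists_edist_lt_of_hausdorffEDist_lt hp hk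
    rw [edist_lt_ofReal] at h
    exact ⟨z, hz, h⟩
  · rw [Metric.hausdorffEDist_comm] at hk
    obtain ⟨p, hp, h⟩ := Metric.exists_edist_lt_of_hausdorffEDist_lt hz hk
    rw [edist_lt_ofReal] at h
    exact ⟨p, hp, h⟩

theorem IsZonoid.convex {n : ℕ} {Z : Set (EuclideanSpace ℝ (Fin n))} (hZ : IsZonoid Z) :
    Convex ℝ Z := by
  intro x hx y hy a b ha hb hab
  rw [← hZ.1.isClosed.closure_eq, Metric.mem_closure_iff]
  intro ε hε
  obtain ⟨P, hP, h1, h2⟩ := hZ.exists_approx (half_pos hε)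
  obtain ⟨p, hp, hxp⟩ := h2 x hx
  obtain ⟨q, hq, hyq⟩ := h2 y hy
  obtain ⟨z, hz, hd⟩ := h1 _ (hP.convex hp hq ha hb hab)
  refine ⟨z, hz, (dist_triangle _ (a • p + b • q) _).trans_lt ?_⟩
  have : dist (a • x + b • y) (a • p + b • q) ≤ ε / 2 := by
    refine (dist_add_add_le _ _ _ _).trans ?_
    rw [dist_smul₀, dist_smul₀, Real.norm_of_nonneg ha, Real.norm_of_nonneg hb]
    nlinarith
  linarith

/-- The approximate form, for a zonoid, of `IsZonotope.exists_translate`. -/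
theorem IsZonoid.exists_translate_approx {n : ℕ} {Z : Set (EuclideanSpace ℝ (Fin n))}
    (hZ : IsZonoid Z) {x y : EuclideanSpace ℝ (Fin n)} (hx : x ∈ Z) (hy : y ∈ Z)
    (u : EuclideanSpace ℝ (Fin n)) {δ : ℝ} (hδ : 0 < δ) :
    ∃ e p : EuclideanSpace ℝ (Fin n),
      (∃ a ∈ Z, dist ((1 / 2 : ℝ) • (x + y) + e) a ≤ 2 * δ) ∧
      (∃ a ∈ Z, dist ((1 / 2 : ℝ) • (x + y) - e) a ≤ 2 * δ) ∧
      (∃ a ∈ Z, dist (p + (1 / 2 : ℝ) • (x - y)) a ≤ 2 * δ) ∧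
      (∃ a ∈ Z, dist (p - (1 / 2 : ℝ) • (x - y)) a ≤ 2 * δ) ∧
      ∀ q ∈ Z,
        inner ℝ u q ≤ inner ℝ u (p + (1 / 2 : ℝ) • (x - y)) + 2 * inner ℝ u e + 2 * δ * ‖u‖ := by
  obtain ⟨P, hP, h1, h2⟩ := hZ.exists_approx hδ
  obtain ⟨x', hx', hxx⟩ := h2 x hx
  obtain ⟨y', hy', hyy⟩ := h2 y hy
  obtain ⟨e, p, hA, hA', hB, hB', hmax⟩ := hP.exists_translate hx' hy' u
  rw [dist_eq_norm] at hxx hyy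
  have hm : ‖(1 / 2 : ℝ) • (x + y) - (1 / 2 : ℝ) • (x' + y')‖ ≤ δ := by
    have : (1 / 2 : ℝ) • (x + y) - (1 / 2 : ℝ) • (x' + y')
        = (1 / 2 : ℝ) • ((x - x') + (y - y')) := by module
    rw [this, norm_smul, Real.norm_of_nonneg (by norm_num)]
    linarith [norm_add_le (x - x') (y - y')]
  have hw : ‖(1 / 2 : ℝ) • (x - y) - (1 / 2 : ℝ) • (x' - y')‖ ≤ δ := by
    have : (1 / 2 : ℝ) • (x - y) - (1 / 2 : ℝ) • (x' - y')
        = (1 / 2 : ℝ) • ((x - x') - (y - y')) := by module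
    rw [this, norm_smul, Real.norm_of_nonneg (by norm_num)]
    linarith [norm_sub_le (x - x') (y - y')]
  set M := (1 / 2 : ℝ) • (x + y)
  set M' := (1 / 2 : ℝ) • (x' + y')
  set W := (1 / 2 : ℝ) • (x - y)
  set W' := (1 / 2 : ℝ) • (x' - y')
  have near : ∀ {r r' : EuclideanSpace ℝ (Fin n)}, ‖r - r'‖ ≤ δ → r' ∈ P →
      ∃ a ∈ Z, dist r a ≤ 2 * δ := by
    intro r r' hr hr'
    obtain ⟨a, ha, had⟩ := h1 _ hr'
    refine ⟨a, ha, (dist_triangle r r' a).trans ?_⟩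
    rw [dist_eq_norm r r']
    linarith
  refine ⟨e, p, near ?_ hA, near ?_ hA', near ?_ hB, near ?_ hB', fun q hq => ?_⟩
  · simpa using hm
  · simpa using hm
  · simpa using hw
  · rw [sub_sub_sub_cancel_left, norm_sub_rev]; exact hw
  · obtain ⟨q', hq', hqq⟩ := h2 q hq
    rw [dist_eq_norm] at hqq
    have i1 : inner ℝ u q - inner ℝ u q' ≤ δ * ‖u‖ := by
      rw [← inner_sub_right]
      refine (real_inner_le_norm _ _).trans ?_
      rw [mul_comm]
      exact mul_le_mul_of_nonneg_right hqq.le (norm_nonneg _)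
    have i2 : |inner ℝ u W - inner ℝ u W'| ≤ δ * ‖u‖ := by
      rw [← inner_sub_right]
      refine (abs_real_inner_le_norm _ _).trans ?_
      rw [mul_comm]
      exact mul_le_mul_of_nonneg_right hw (norm_nonneg _)
    have i3 := abs_le.1 i2
    have j := hmax q' hq'
    simp only [inner_add_right] at j ⊢
    linarith

/-! ### Translates of a face in other support sets -/

/-- If `F` is an extreme set of a zonoid `Z` and `u` is orthogonal to `F`, then the support set of `Z`
in direction `u` contains a translate of every segment with endpoints in `F`. In the limit of
`IsZonotope.exists_translate`, the midpoint of `x` and `y` can be moved by `± e` within `Z`, hence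
within `F`, so `⟪u, e⟫ = 0`. -/
theorem IsZonoid.exists_translate_face {n : ℕ} {Z F : Set (EuclideanSpace ℝ (Fin n))}
    (hZ : IsZonoid Z) (hF : Convex ℝ F) (hext : IsExtreme ℝ Z F)
    {x y : EuclideanSpace ℝ (Fin n)} (hx : x ∈ F) (hy : y ∈ F)
    {u : EuclideanSpace ℝ (Fin n)} (hu : u ∈ (vectorSpan ℝ F)ᗮ) :
    ∃ p, p + (1 / 2 : ℝ) • (x - y) ∈ Z ∧ p - (1 / 2 : ℝ) • (x - y) ∈ Z ∧
      ∀ q ∈ Z, inner ℝ u q ≤ inner ℝ u p := by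
  have hδ : ∀ k : ℕ, (0 : ℝ) < 1 / ((k : ℝ) + 1) := fun k => Nat.one_div_pos_of_nat
  have hδ0 : Tendsto (fun k : ℕ => 1 / ((k : ℝ) + 1)) atTop (𝓝 0) :=
    tendsto_one_div_add_atTop_nhds_zero_nat
  choose e p hA hA' hB hB' hmax using fun k : ℕ =>
    hZ.exists_translate_approx (hext.subset hx) (hext.subset hy) u (hδ k)
  choose A hAZ hAd using hA
  choose A' hAZ' hAd' using hA'
  choose B hBZ hBd using hB
  choose B' hBZ' hBd' using hB'
  have hmF : (1 / 2 : ℝ) • (x + y) ∈ F := by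
    rw [smul_add]
    exact hF hx hy (by norm_num) (by norm_num) (by norm_num)
  set m := (1 / 2 : ℝ) • (x + y)
  set w := (1 / 2 : ℝ) • (x - y)
  obtain ⟨⟨a, b⟩, -, φ, hφ, hab⟩ := (hZ.1.prod hZ.1).tendsto_subseq
    (x := fun k => (A k, B k)) fun k => ⟨hAZ k, hBZ k⟩
  have hAlim : Tendsto (fun k => A (φ k)) atTop (𝓝 a) := (continuous_fst.tendsto _).comp hab
  have hBlim : Tendsto (fun k => B (φ k)) atTop (𝓝 b) := (continuous_snd.tendsto _).comp hab
  have hδφ : Tendsto (fun k => 2 * (1 / ((φ k : ℝ) + 1))) atTop (𝓝 0) := by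
    simpa using (hδ0.comp hφ.tendsto_atTop).const_mul 2
  have lim_of : ∀ {r s : ℕ → EuclideanSpace ℝ (Fin n)} {l},
      (∀ k, dist (r k) (s k) ≤ 2 * (1 / ((φ k : ℝ) + 1))) → Tendsto r atTop (𝓝 l) →
        Tendsto s atTop (𝓝 l) := fun h hr =>
    (tendsto_iff_of_dist (squeeze_zero (fun _ => dist_nonneg) h hδφ)).1 hr
  have he : Tendsto (fun k => e (φ k)) atTop (𝓝 (a - m)) := by
    have := lim_of (fun k => by rw [dist_comm]; exact hAd (φ k)) hAlim
    simpa using this.sub_const m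
  have hp : Tendsto (fun k => p (φ k)) atTop (𝓝 (b - w)) := by
    have := lim_of (fun k => by rw [dist_comm]; exact hBd (φ k)) hBlim
    simpa using this.sub_const w
  have hcl := hZ.1.isClosed
  have haZ : a ∈ Z := hcl.mem_of_tendsto hAlim (Eventually.of_forall fun k => hAZ _)
  have hbZ : b ∈ Z := hcl.mem_of_tendsto hBlim (Eventually.of_forall fun k => hBZ _)
  have haZ' : m - (a - m) ∈ Z := hcl.mem_of_tendsto
    (lim_of (fun k => hAd' (φ k)) (tendsto_const_nhds.sub he))
    (Eventually.of_forall fun k => hAZ' _)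
  have hbZ' : b - w - w ∈ Z := hcl.mem_of_tendsto
    (lim_of (fun k => hBd' (φ k)) (hp.sub_const w)) (Eventually.of_forall fun k => hBZ' _)
  have haF : a ∈ F := by
    refine hext.left_mem_of_mem_openSegment haZ haZ' hmF
      ⟨1 / 2, 1 / 2, by norm_num, by norm_num, by norm_num, ?_⟩
    module
  -- `a - m` is the limit of the displacements `e`; it lies in the direction of `F`, so `u` kills it
  have hue : inner ℝ u (a - m) = 0 :=
    Submodule.inner_left_of_mem_orthogonal (vsub_mem_vectorSpan ℝ haF hmF) hu
  have huw : inner ℝ u w = 0 := by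
    have : inner ℝ u (x - y) = 0 :=
      Submodule.inner_left_of_mem_orthogonal (vsub_mem_vectorSpan ℝ hx hy) hu
    rw [inner_smul_right, this, mul_zero]
  refine ⟨b - w, by simpa using hbZ, hbZ', fun q hq => ?_⟩
  have hlim : Tendsto (fun k => inner ℝ u (p (φ k) + w) + 2 * inner ℝ u (e (φ k))
      + 2 * (1 / ((φ k : ℝ) + 1)) * ‖u‖) atTop
      (𝓝 (inner ℝ u (b - w + w) + 2 * inner ℝ u (a - m) + 0 * ‖u‖)) :=
    ((tendsto_const_nhds.inner (hp.add_const w)).add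
      ((tendsto_const_nhds.inner he).const_mul 2)).add (hδφ.mul_const _)
  have := ge_of_tendsto' hlim fun k => hmax (φ k) q hq
  rw [hue, inner_add_right, huw] at this
  linarith

/-! ### The belt of a face meets every hyperplane through the origin -/

/-- The sphere of a subspace `M` of dimension at least two is connected. If over every `u ∈ M` there is
a `v` such that `v ± w` lie in the support set of `Z` in direction `u`, then the closed sets of
unit `u` with such a `v` on either side of the hyperplane `θᗮ` cover this sphere and are antipodal
to each other, so they meet; by convexity of the support sets some `v` lies on `θᗮ`. -/
theorem exists_support_inner_eq_zero {n : ℕ} {Z : Set (EuclideanSpace ℝ (Fin n))}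
    (hZ : IsCompact Z) (hconv : Convex ℝ Z) (hsymm : -Z = Z)
    (M : Submodule ℝ (EuclideanSpace ℝ (Fin n))) (hM : 2 ≤ Module.finrank ℝ M)
    (w : EuclideanSpace ℝ (Fin n))
    (h : ∀ u ∈ M, ∃ v, v + w ∈ Z ∧ v - w ∈ Z ∧ ∀ q ∈ Z, inner ℝ u q ≤ inner ℝ u v)
    (θ : EuclideanSpace ℝ (Fin n)) :
    ∃ u v, u ≠ 0 ∧ v + w ∈ Z ∧ v - w ∈ Z ∧ (∀ q ∈ Z, inner ℝ u q ≤ inner ℝ u v) ∧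
      inner ℝ v θ = 0 := by
  have hneg : ∀ {z}, z ∈ Z → -z ∈ Z := fun {z} hz => by
    rw [← hsymm]; simpa using hz
  let V : Set (M × EuclideanSpace ℝ (Fin n)) := {uv | uv.2 + w ∈ Z ∧ uv.2 - w ∈ Z ∧
    ∀ q ∈ Z, inner ℝ (uv.1 : EuclideanSpace ℝ (Fin n)) q
      ≤ inner ℝ (uv.1 : EuclideanSpace ℝ (Fin n)) uv.2}
  let S : Set M := Metric.sphere 0 1
  have hVcl : IsClosed V := by
    have h1 : IsClosed {uv : M × EuclideanSpace ℝ (Fin n) | uv.2 + w ∈ Z} :=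
      hZ.isClosed.preimage (by fun_prop)
    have h2 : IsClosed {uv : M × EuclideanSpace ℝ (Fin n) | uv.2 - w ∈ Z} :=
      hZ.isClosed.preimage (by fun_prop)
    have h3 : IsClosed {uv : M × EuclideanSpace ℝ (Fin n) | ∀ q ∈ Z,
        inner ℝ (uv.1 : EuclideanSpace ℝ (Fin n)) q
          ≤ inner ℝ (uv.1 : EuclideanSpace ℝ (Fin n)) uv.2} := by
      simp only [Set.ofPred_forall]
      exact isClosed_biInter fun q _ => isClosed_le (by fun_prop) (by fun_prop)
    exact h1.inter (h2.inter h3)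
  have hcpt : IsCompact (V ∩ S ×ˢ ((fun z => z - w) '' Z)) :=
    ((isCompact_sphere _ _).prod (hZ.image (by fun_prop))).inter_left hVcl
  let T : Set M := Prod.fst '' ((V ∩ S ×ˢ ((fun z => z - w) '' Z)) ∩ {uv | 0 ≤ inner ℝ uv.2 θ})
  let T' : Set M := Prod.fst '' ((V ∩ S ×ˢ ((fun z => z - w) '' Z)) ∩ {uv | inner ℝ uv.2 θ ≤ 0})
  have hT : IsClosed T :=
    ((hcpt.inter_right (isClosed_le (by fun_prop) (by fun_prop))).image continuous_fst).isClosed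
  have hT' : IsClosed T' :=
    ((hcpt.inter_right (isClosed_le (by fun_prop) (by fun_prop))).image continuous_fst).isClosed
  have hcov : S ⊆ T ∪ T' := by
    intro u hu
    obtain ⟨v, hv1, hv2, hv3⟩ := h u u.2
    have hmem : (u, v) ∈ V ∩ S ×ˢ ((fun z => z - w) '' Z) :=
      ⟨⟨hv1, hv2, hv3⟩, hu, v + w, hv1, by simp⟩
    rcases le_total 0 (inner ℝ v θ) with h0 | h0
    · exact Or.inl ⟨(u, v), ⟨hmem, h0⟩, rfl⟩
    · exact Or.inr ⟨(u, v), ⟨hmem, h0⟩, rfl⟩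
  have hVneg : ∀ {u v}, (u, v) ∈ V ∩ S ×ˢ ((fun z => z - w) '' Z) →
      (-u, -v) ∈ V ∩ S ×ˢ ((fun z => z - w) '' Z) := by
    rintro u v ⟨⟨h1, h2, h3⟩, hu, -⟩
    have h1' : -v + w ∈ Z := by convert hneg h2 using 1; abel
    have h2' : -v - w ∈ Z := by convert hneg h1 using 1; abel
    refine ⟨⟨h1', h2', fun q hq => ?_⟩, by simpa [S] using hu, -v + w, h1', by simp⟩
    simpa using h3 _ (hneg hq)
  have hTneg : ∀ {u}, u ∈ T → -u ∈ T' := by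
    rintro _ ⟨⟨u, v⟩, ⟨hm, h0⟩, rfl⟩
    exact ⟨(-u, -v), ⟨hVneg hm, by simpa using h0⟩, rfl⟩
  have hTneg' : ∀ {u}, u ∈ T' → -u ∈ T := by
    rintro _ ⟨⟨u, v⟩, ⟨hm, h0⟩, rfl⟩
    exact ⟨(-u, -v), ⟨hVneg hm, by simpa using h0⟩, rfl⟩
  have hSneg : ∀ {u}, u ∈ S → -u ∈ S := fun hu => by simpa [S] using hu
  have : Nontrivial M := Module.nontrivial_of_finrank_pos (R := ℝ) (by omega)
  obtain ⟨u₀, hu₀⟩ : S.Nonempty := NormedSpace.sphere_nonempty.2 zero_le_one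
  have hne : (S ∩ T).Nonempty ∧ (S ∩ T').Nonempty := by
    rcases hcov hu₀ with h0 | h0
    · exact ⟨⟨u₀, hu₀, h0⟩, ⟨-u₀, hSneg hu₀, hTneg h0⟩⟩
    · exact ⟨⟨-u₀, hSneg hu₀, hTneg' h0⟩, ⟨u₀, hu₀, h0⟩⟩
  have hrank : 1 < Module.rank ℝ M := by
    have := Module.lt_rank_of_lt_finrank (R := ℝ) (M := M) (n := 1) (by omega)
    simpa using this
  obtain ⟨u, huS, ⟨⟨_, v₁⟩, ⟨⟨hv₁, -⟩, h₁⟩, rfl⟩, ⟨⟨u, v₂⟩, ⟨⟨hv₂, -⟩, h₂⟩, hu⟩⟩ :=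
    isPreconnected_closed_iff.1 (isPreconnected_sphere hrank (0 : M) 1) T T' hT hT' hcov hne.1 hne.2
  obtain rfl : u = _ := hu
  simp only [Set.mem_ofPred_eq] at h₁ h₂
  obtain ⟨a, b, ha, hb, hab, h0⟩ : ∃ a b : ℝ, 0 ≤ a ∧ 0 ≤ b ∧ a + b = 1 ∧
      a * inner ℝ v₁ θ + b * inner ℝ v₂ θ = 0 := by
    have hz : (0 : ℝ) ∈ segment ℝ (inner ℝ v₂ θ) (inner ℝ v₁ θ) := by
      rw [segment_eq_Icc (h₂.trans h₁)]
      exact ⟨h₂, h₁⟩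
    obtain ⟨b, a, hb, ha, hab, h0⟩ := hz
    exact ⟨a, b, ha, hb, by linarith, by simpa [add_comm] using h0⟩
  have hsplit : w = a • w + b • w := by rw [← add_smul, hab, one_smul]
  refine ⟨u, a • v₁ + b • v₂, ?_, ?_, ?_, fun q hq => ?_, ?_⟩
  · have : ‖u‖ = 1 := by simpa [S] using huS
    intro h0
    rw [ZeroMemClass.coe_eq_zero.1 h0, norm_zero] at this
    exact zero_ne_one this
  · convert hconv hv₁.1 hv₂.1 ha hb hab using 1
    nth_rewrite 1 [hsplit]
    module
  · convert hconv hv₁.2.1 hv₂.2.1 ha hb hab using 1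
    nth_rewrite 1 [hsplit]
    module
  · have e1 := hv₁.2.2 q hq
    have e2 := hv₂.2.2 q hq
    simp only [inner_add_right, inner_smul_right]
    calc inner ℝ (u : EuclideanSpace ℝ (Fin n)) q
        = a * inner ℝ (u : EuclideanSpace ℝ (Fin n)) q
          + b * inner ℝ (u : EuclideanSpace ℝ (Fin n)) q := by rw [← add_mul, hab, one_mul]
      _ ≤ _ := add_le_add (mul_le_mul_of_nonneg_left e1 ha) (mul_le_mul_of_nonneg_left e2 hb)
  · simpa [inner_add_left, real_inner_smul_left] using h0

/-! ### Second differences of a zonoid norm -/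

/-- For a sum of absolute values of linear forms, the second difference at `v` in direction `w`
is a sum of nonnegative terms, and the term of `θ i` is at least `2 (|⟪w, θ i⟫| - ε ‖θ i‖)` if
`|⟪v, θ i⟫| ≤ ε ‖θ i‖`. -/
theorem sum_secondDiff_ge {E : Type*} [NormedAddCommGroup E] [InnerProductSpace ℝ E] {m : ℕ}
    (θ : Fin m → E) (w : E) (T : Finset E) {ε : ℝ}
    (hT : ∀ i, ∃ v ∈ T, |inner ℝ v (θ i)| ≤ ε * ‖θ i‖) :
    2 * (∑ i, |inner ℝ w (θ i)| - ε * ∑ i, ‖θ i‖) ≤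
      ∑ v ∈ T, (∑ i, |inner ℝ (v + w) (θ i)| + ∑ i, |inner ℝ (v - w) (θ i)|
        - 2 * ∑ i, |inner ℝ v (θ i)|) := by
  have e : ∀ v ∈ T, (∑ i, |inner ℝ (v + w) (θ i)| + ∑ i, |inner ℝ (v - w) (θ i)|
        - 2 * ∑ i, |inner ℝ v (θ i)|) = ∑ i, (|inner ℝ (v + w) (θ i)| + |inner ℝ (v - w) (θ i)|
        - 2 * |inner ℝ v (θ i)|) := fun v _ => by
    rw [Finset.mul_sum, ← Finset.sum_add_distrib, ← Finset.sum_sub_distrib]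
  rw [Finset.sum_congr rfl e, Finset.sum_comm, Finset.mul_sum, ← Finset.sum_sub_distrib,
    Finset.mul_sum]
  refine Finset.sum_le_sum fun i _ => ?_
  obtain ⟨v, hv, hvi⟩ := hT i
  have hnn : ∀ v ∈ T, 0 ≤ |inner ℝ (v + w) (θ i)| + |inner ℝ (v - w) (θ i)|
      - 2 * |inner ℝ v (θ i)| := by
    intro v _
    rw [inner_add_left, inner_sub_left]
    have := abs_add_le (inner ℝ v (θ i) + inner ℝ w (θ i)) (inner ℝ v (θ i) - inner ℝ w (θ i))
    rw [add_add_sub_cancel, ← two_mul, abs_mul, abs_two] at this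
    linarith
  refine le_trans ?_ (Finset.single_le_sum hnn hv)
  rw [inner_add_left, inner_sub_left]
  have := abs_sub (inner ℝ v (θ i) + inner ℝ w (θ i)) (inner ℝ v (θ i) - inner ℝ w (θ i))
  rw [add_sub_sub_cancel, ← two_mul, abs_mul, abs_two] at this
  linarith

/-- Let `B` be an origin-symmetric zonoid with support function `N`, and let `V` be a bounded set that
meets every hyperplane through the origin. If `N ≥ 1` on `V` and `N ≤ 1` on `V ± w`, then
`N w = 0`. -/
theorem IsZonoid.inner_le_zero_of_secondDiff {n : ℕ} {B : Set (EuclideanSpace ℝ (Fin n))}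
    (hB : IsZonoid B) (hsymm : ∀ y ∈ B, -y ∈ B) {V : Set (EuclideanSpace ℝ (Fin n))}
    (hV : TotallyBounded V) {w : EuclideanSpace ℝ (Fin n)}
    (hV0 : ∀ θ, ∃ v ∈ V, inner ℝ v θ = 0) (hV1 : ∀ v ∈ V, ∃ y ∈ B, 1 ≤ inner ℝ v y)
    (hVp : ∀ v ∈ V, ∀ y ∈ B, inner ℝ (v + w) y ≤ 1)
    (hVm : ∀ v ∈ V, ∀ y ∈ B, inner ℝ (v - w) y ≤ 1) :
    ∀ y ∈ B, inner ℝ w y ≤ 0 := by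
  intro y₀ hy₀
  by_contra! hpos
  obtain ⟨r, hr⟩ := hB.1.isBounded.exists_norm_le
  have hr0 : 0 ≤ r := (norm_nonneg _).trans (hr y₀ hy₀)
  set η := inner ℝ w y₀
  -- `∑ ‖θ i‖ ≤ n (r + 1)` for zonotopes at distance less than `1` from `B`
  set C : ℝ := n * (r + 1) with hC
  have hC0 : 0 ≤ C := by positivity
  set ε : ℝ := η / (2 * (C + 1)) with hε
  have hε0 : 0 < ε := by positivity
  have hεC : ε * C ≤ η / 2 := by
    rw [hε, div_mul_eq_mul_div, div_le_div_iff₀ (by positivity) (by positivity)]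
    nlinarith
  obtain ⟨T₀, hT₀V, hT₀fin, hT₀⟩ := Metric.finite_approx_of_totallyBounded hV ε hε0
  set T := hT₀fin.toFinset
  have hTV : ∀ v ∈ T, v ∈ V := fun v hv => hT₀V (hT₀fin.mem_toFinset.1 hv)
  -- errors `δ ‖x‖` in the values `N x` change the second differences over `T` by at most `δ D`
  set D : ℝ := ∑ v ∈ T, (‖v + w‖ + ‖v - w‖ + 2 * ‖v‖) with hD
  have hD0 : 0 ≤ D := Finset.sum_nonneg fun v _ => by positivity
  obtain ⟨δ, hδ0, hδ1, hδ⟩ : ∃ δ : ℝ, 0 < δ ∧ δ ≤ 1 ∧ δ * (D + 2 * ‖w‖) < η := by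
    refine ⟨min 1 (η / (D + 2 * ‖w‖ + 1)), by positivity, min_le_left _ _, ?_⟩
    have hd : 0 < D + 2 * ‖w‖ + 1 := by positivity
    calc min 1 (η / (D + 2 * ‖w‖ + 1)) * (D + 2 * ‖w‖)
        ≤ η / (D + 2 * ‖w‖ + 1) * (D + 2 * ‖w‖) :=
          mul_le_mul_of_nonneg_right (min_le_right _ _) (by positivity)
      _ < η := by
          rw [div_mul_eq_mul_div, div_lt_iff₀ hd]
          nlinarith
  obtain ⟨P, hP, hPB, hBP⟩ := hB.exists_approx hδ0
  obtain ⟨m, c, θ, hm⟩ := hP.exists_repr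
  -- `N x` is the support function of the translate of `P` that is centered at the origin
  set N : EuclideanSpace ℝ (Fin n) → ℝ := fun x => ∑ i, |inner ℝ x (θ i)| with hN
  have hstep : ∀ x a b : EuclideanSpace ℝ (Fin n), dist a b < δ →
      inner ℝ x a ≤ inner ℝ x b + δ * ‖x‖ := by
    intro x a b hab
    rw [dist_eq_norm] at hab
    have : inner ℝ x (a - b) ≤ ‖x‖ * ‖a - b‖ := real_inner_le_norm _ _
    rw [inner_sub_right] at this
    nlinarith [norm_nonneg x]
  have hupper : ∀ x, ∀ p ∈ P, inner ℝ x p ≤ inner ℝ x c + N x := by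
    intro x p hp
    obtain ⟨f, hf, rfl⟩ := (hm p).1 hp
    simp only [inner_add_right, inner_sum, inner_smul_right]
    refine add_le_add le_rfl (Finset.sum_le_sum fun i _ => ?_)
    refine (le_abs_self _).trans ?_
    rw [abs_mul]
    exact mul_le_of_le_one_left (abs_nonneg _) (hf i)
  have hattain : ∀ x, ∃ p ∈ P, inner ℝ x p = inner ℝ x c + N x := by
    intro x
    refine ⟨c + ∑ i, (SignType.sign (inner ℝ x (θ i)) : ℝ) • θ i, (hm _).2 ⟨_, fun i => ?_, rfl⟩, ?_⟩
    · rcases SignType.trichotomy (SignType.sign (inner ℝ x (θ i))) with h | h | h <;>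
        rw [h] <;> simp
    · simp only [inner_add_right, inner_sum, inner_smul_right, hN, sign_mul_self]
  have hNneg : ∀ x, N (-x) = N x := fun x => by simp [hN]
  -- averaging the estimates for `x` and `-x` removes the center `c`
  have hlow : ∀ x, ∀ y ∈ B, inner ℝ x y ≤ N x + δ * ‖x‖ := by
    intro x y hy
    obtain ⟨p, hp, hd⟩ := hBP y hy
    obtain ⟨p', hp', hd'⟩ := hBP _ (hsymm y hy)
    have h1 := (hstep x _ _ hd).trans (add_le_add (hupper x p hp) le_rfl)
    have h2 := (hstep (-x) _ _ hd').trans (add_le_add (hupper (-x) p' hp') le_rfl)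
    rw [hNneg, norm_neg, inner_neg_neg, inner_neg_left] at h2
    linarith
  have hup : ∀ x h, (∀ y ∈ B, inner ℝ x y ≤ h) → N x ≤ h + δ * ‖x‖ := by
    intro x h hx
    obtain ⟨p, hp, he⟩ := hattain x
    obtain ⟨p', hp', he'⟩ := hattain (-x)
    obtain ⟨z, hz, hd⟩ := hPB p hp
    obtain ⟨z', hz', hd'⟩ := hPB p' hp'
    have h1 := hstep x _ _ hd
    have h2 := hstep (-x) _ _ hd'
    have h3 := hx z hz
    have h4 := hx _ (hsymm z' hz')
    rw [hNneg, inner_neg_left x c] at he'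
    rw [inner_neg_right] at h4
    rw [norm_neg, inner_neg_left x z'] at h2
    linarith
  have hmass : ∑ i, ‖θ i‖ ≤ C := by
    have h1 : ∀ i, ‖θ i‖ ≤ ∑ j : Fin n, |inner ℝ (EuclideanSpace.basisFun (Fin n) ℝ j) (θ i)| := by
      intro i
      conv_lhs => rw [← (EuclideanSpace.basisFun (Fin n) ℝ).sum_repr' (θ i)]
      refine (norm_sum_le _ _).trans (Finset.sum_le_sum fun j _ => ?_)
      rw [norm_smul, OrthonormalBasis.norm_eq_one, mul_one, Real.norm_eq_abs]
    refine (Finset.sum_le_sum fun i _ => h1 i).trans ?_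
    rw [Finset.sum_comm]
    have h2 : ∀ j ∈ (Finset.univ : Finset (Fin n)),
        ∑ i, |inner ℝ (EuclideanSpace.basisFun (Fin n) ℝ j) (θ i)| ≤ r + 1 := by
      intro j _
      have := hup (EuclideanSpace.basisFun (Fin n) ℝ j) r fun y hy => by
        refine (real_inner_le_norm _ _).trans ?_
        rw [OrthonormalBasis.norm_eq_one, one_mul]
        exact hr y hy
      rw [OrthonormalBasis.norm_eq_one, mul_one] at this
      exact this.trans (by linarith)
    refine (Finset.sum_le_sum h2).trans ?_
    rw [Finset.sum_const, Finset.card_univ, Fintype.card_fin, nsmul_eq_mul]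
  have hnet : ∀ i, ∃ v ∈ T, |inner ℝ v (θ i)| ≤ ε * ‖θ i‖ := by
    intro i
    obtain ⟨v, hv, h0⟩ := hV0 (θ i)
    obtain ⟨v', hv', hd⟩ := Set.mem_iUnion₂.1 (hT₀ hv)
    refine ⟨v', hT₀fin.mem_toFinset.2 hv', ?_⟩
    have : inner ℝ v' (θ i) = inner ℝ (v' - v) (θ i) := by rw [inner_sub_left, h0, sub_zero]
    rw [this]
    refine (abs_real_inner_le_norm _ _).trans (mul_le_mul_of_nonneg_right ?_ (norm_nonneg _))
    rw [← dist_eq_norm, dist_comm]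
    exact (Metric.mem_ball.1 hd).le
  have hmain := sum_secondDiff_ge θ w T hnet
  have hsd : ∑ v ∈ T, (N (v + w) + N (v - w) - 2 * N v) ≤ δ * D := by
    rw [hD, Finset.mul_sum]
    refine Finset.sum_le_sum fun v hv => ?_
    have h1 := hup _ _ (hVp v (hTV v hv))
    have h2 := hup _ _ (hVm v (hTV v hv))
    obtain ⟨y, hy, hy1⟩ := hV1 v (hTV v hv)
    have h3 := hlow v y hy
    linarith
  have hw := hlow w y₀ hy₀
  have hfin : 2 * (N w - ε * ∑ i, ‖θ i‖) ≤ δ * D := hmain.trans hsd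
  have := mul_le_mul_of_nonneg_left hmass hε0.le
  nlinarith

/-! ### Polars and proper faces -/

/-- If the polar of `Z` is bounded, then every nonzero `u` has positive maximum over `Z` (else all
multiples of `u` are polar points), and rescaling `u` gives a polar point that norms the maximizers. -/
theorem exists_mem_polarBody_inner_eq_one {n : ℕ} {Z : Set (EuclideanSpace ℝ (Fin n))}
    (hB : Bornology.IsBounded (polarBody Z)) {u v : EuclideanSpace ℝ (Fin n)} (hu : u ≠ 0)
    (hv : ∀ q ∈ Z, inner ℝ u q ≤ inner ℝ u v) : ∃ y ∈ polarBody Z, inner ℝ v y = 1 := by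
  have hpos : 0 < inner ℝ u v := by
    by_contra! hle
    obtain ⟨r, hr⟩ := hB.exists_norm_le
    have hunorm : 0 < ‖u‖ := norm_pos_iff.2 hu
    have hmem : ((|r| + 1) / ‖u‖) • u ∈ polarBody Z := by
      intro q hq
      rw [inner_smul_right, real_inner_comm]
      have : (|r| + 1) / ‖u‖ * inner ℝ u q ≤ 0 :=
        mul_nonpos_of_nonneg_of_nonpos (by positivity) ((hv q hq).trans hle)
      linarith
    have := hr _ hmem
    rw [norm_smul, Real.norm_of_nonneg (by positivity), div_mul_cancel₀ _ hunorm.ne'] at this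
    linarith [le_abs_self r]
  refine ⟨(inner ℝ u v)⁻¹ • u, fun q hq => ?_, ?_⟩
  · rw [inner_smul_right, real_inner_comm u q, inv_mul_le_iff₀ hpos, mul_one]
    exact hv q hq
  · rw [inner_smul_right, real_inner_comm u v, inv_mul_cancel₀ hpos.ne']

theorem eq_zero_of_inner_polarBody_le_zero {n : ℕ} {Z : Set (EuclideanSpace ℝ (Fin n))}
    (hZ : Bornology.IsBounded Z) {w : EuclideanSpace ℝ (Fin n)}
    (hw : ∀ y ∈ polarBody Z, inner ℝ w y ≤ 0) : w = 0 := by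
  by_contra hne
  obtain ⟨r, hr⟩ := hZ.exists_norm_le
  have hwnorm : 0 < ‖w‖ := norm_pos_iff.2 hne
  set t : ℝ := ((|r| + 1) * ‖w‖)⁻¹ with ht
  have ht0 : 0 < t := by positivity
  have hmem : t • w ∈ polarBody Z := by
    intro q hq
    rw [inner_smul_right, ht, inv_mul_le_iff₀ (by positivity), mul_one]
    refine (real_inner_le_norm _ _).trans (mul_le_mul_of_nonneg_right ?_ (norm_nonneg _))
    linarith [hr q hq, le_abs_self r]
  have := hw _ hmem
  rw [inner_smul_right, real_inner_self_eq_norm_sq] at this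
  have : 0 < t * ‖w‖ ^ 2 := by positivity
  linarith

/-- A face with an interior point `a` is the whole body: every `z ∈ K` is an end point of a
segment in `K` through `a`. -/
theorem IsProperFace.vectorSpan_ne_top {n : ℕ} {K F : Set (EuclideanSpace ℝ (Fin n))}
    (hF : IsProperFace K F) : vectorSpan ℝ F ≠ ⊤ := by
  intro htop
  have haff : affineSpan ℝ F = ⊤ := by
    rw [← AffineSubspace.direction_eq_top_iff_of_nonempty (hF.nonempty.mono (subset_affineSpan ℝ F)),
      direction_affineSpan]
    exact htop
  obtain ⟨a, ha⟩ := hF.convex.interior_nonempty_iff_affineSpan_eq_top.2 haff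
  refine hF.ne (hF.isExtreme.subset.antisymm fun z hz => ?_)
  have hcont : Tendsto (fun t : ℝ => a + t • (a - z)) (𝓝[>] 0) (𝓝 a) := by
    have : Continuous fun t : ℝ => a + t • (a - z) := by fun_prop
    have := this.tendsto 0
    rw [zero_smul, add_zero] at this
    exact this.mono_left nhdsWithin_le_nhds
  obtain ⟨t, htF, ht0⟩ := ((hcont.eventually (mem_interior_iff_mem_nhds.1 ha)).and
    self_mem_nhdsWithin).exists
  have ht0' : 0 < t := ht0
  refine hF.isExtreme.left_mem_of_mem_openSegment hz (hF.isExtreme.subset htF)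
    (interior_subset ha) ⟨t / (1 + t), 1 / (1 + t), by positivity, by positivity, by field_simp; ring, ?_⟩
  have h1 : t / (1 + t) = t * (1 / (1 + t)) := by ring
  have h2 : (1 / (1 + t)) * (1 + t) = 1 := by field_simp
  calc (t / (1 + t)) • z + (1 / (1 + t)) • (a + t • (a - z))
      = ((1 / (1 + t)) * (1 + t)) • a := by rw [h1]; module
    _ = a := by rw [h2, one_smul]

theorem mainTheorem2 (n : ℕ) (hn : 3 ≤ n) (Z : Set (EuclideanSpace ℝ (Fin n)))
    (hZ : IsZonoid Z) (hdim : affineDim Z = n) (hsymm : -Z = Z)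
    (hpolar : IsZonoid (polarBody Z))
    (F : Set (EuclideanSpace ℝ (Fin n))) (hF : IsProperFace Z F) :
    affineDim F = 0 ∨ affineDim F = n - 1 := by
  by_contra! hcon
  obtain ⟨h0, h1⟩ := hcon
  unfold affineDim at h0 h1
  have hlt : Module.finrank ℝ (vectorSpan ℝ F) < n := by
    simpa using Submodule.finrank_lt hF.vectorSpan_ne_top
  have hM : 2 ≤ Module.finrank ℝ (vectorSpan ℝ F)ᗮ := by
    have := (vectorSpan ℝ F).finrank_add_finrank_orthogonal
    rw [finrank_euclideanSpace_fin] at this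
    omega
  obtain ⟨x, hx, y, hy, hxy⟩ : ∃ x ∈ F, ∃ y ∈ F, x ≠ y := by
    by_contra! hsub
    refine h0 ?_
    rw [(vectorSpan_eq_bot_iff_subsingleton ℝ).2 hsub, finrank_bot]
  set w := (1 / 2 : ℝ) • (x - y) with hw
  -- the belt of `F`: support sets of `Z` in directions orthogonal to `F`
  have hbelt := exists_support_inner_eq_zero hZ.1 hZ.convex hsymm _ hM w fun u hu =>
    hZ.exists_translate_face hF.convex hF.isExtreme hx hy hu
  have hneg : ∀ q ∈ Z, -q ∈ Z := fun q hq => by rw [← hsymm]; simpa using hq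
  let V : Set (EuclideanSpace ℝ (Fin n)) :=
    {v | v + w ∈ Z ∧ v - w ∈ Z ∧ ∃ u, u ≠ 0 ∧ ∀ q ∈ Z, inner ℝ u q ≤ inner ℝ u v}
  have hVtb : TotallyBounded V := by
    refine (hZ.1.image (f := fun z => z - w) (by fun_prop)).totallyBounded.subset ?_
    exact fun v hv => ⟨v + w, hv.1, by simp⟩
  have hw0 : w = 0 := by
    refine eq_zero_of_inner_polarBody_le_zero hZ.1.isBounded
      (hpolar.inner_le_zero_of_secondDiff ?_ hVtb ?_ ?_ ?_ ?_)
    · intro y hy q hq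
      simpa using hy _ (hneg q hq)
    · intro θ
      obtain ⟨u, v, hu, hv1, hv2, hv3, hvθ⟩ := hbelt θ
      exact ⟨v, ⟨hv1, hv2, u, hu, hv3⟩, hvθ⟩
    · rintro v ⟨-, -, u, hu, hv⟩
      obtain ⟨y, hy, hvy⟩ := exists_mem_polarBody_inner_eq_one hpolar.1.isBounded hu hv
      exact ⟨y, hy, hvy.ge⟩
    · exact fun v hv y hy => hy _ hv.1
    · exact fun v hv y hy => hy _ hv.2.1
  rw [hw, smul_eq_zero, sub_eq_zero] at hw0
  exact hw0.elim (by norm_num) hxy
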